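/- **Setting.** Let $M$ be a space, $N\subset M$ a subspace triangulated as a finite-dimensional flag complex, and $\omega:M\to M$ a homeomorphism with $\omega^2=1$ that maps $N$ to itself by a simplicial automorphism; put $C_2=\langle\omega\rangle$. (For example, $M$ is a compact manifold with boundary $N=\partial M$.) Let $p:\widetilde M\to M$ be a surjective covering map with $\widetilde M$ simply connected, let $\widetilde N=p^{-1}(N)$ carry the lifted triangulation (the one for which $p:\widetilde N\to N$ is simplicial and injective on each simplex), and let $\Gamma$ be the group of all homeomorphisms of $\widetilde M$ that are lifts of elements of $C_2$. It acts on $\widetilde N$ by simplicial automorphisms. Let $\widetilde W$ be the right-angled Coxeter group with one generator $s_i$ for each vertex $i$ of $\widetilde N$ and relations $s_i^2=1$, and $(s_is_j)^2=1$ whenever $\{i,j\}$ spans an edge. $\Gamma$ acts on $\widetilde W$ by permuting the generators, written $w\mapsto w^\gamma$; form $\widetilde W\rtimes\Gamma$. For $x\in\widetilde M$ let $\widetilde W_x$ be the (special) subgroup generated by those $s_i$ for which $x$ lies in the closed star of $i$ in the barycentric subdivision of $\widetilde N$ (so $\widetilde W_x=1$ if $x\notin\widetilde N$). Let $$\mathcal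 U(\widetilde M,\widetilde N,\Gamma)=\widetilde W\times\widetilde M/\!\sim,\qquad (w,x)\sim(w',x')\iff x=x'\text{ and }w^{-1}w'\in\widetilde W_x,$$ with the action $(v,\gamma).[w,x]=[vw^\gamma,\gamma.x]$ of $\widetilde W\rtimes\Gamma$. **Proposition.** 1. Every subgroup $H$ of $\widetilde W\rtimes\Gamma$ that fixes some point of $\mathcal U(\widetilde M,\widetilde N,\Gamma)$ is finite. 2. If $x\in\widetilde M\setminus\widetilde N$ and $w\in\widetilde W$, then the stabilizer of $[w,x]$ in $\widetilde W\rtimes\Gamma$ is finite of order at most $2$. 3. If $y\in\widetilde N$ and $w\in\widetilde W$, then $\widetilde W_y$ is finite, the stabilizer $\Gamma_y$ of $y$ in $\Gamma$ has order at most $2$, and there is a short exact sequence $$1\to\widetilde W_y\to \mathrm{Stab}([w,y])\to\Gamma_y\to 1$$ whose first map is $v\mapsto(wvw^{-1},1)$ and whose second map is $(v,\gamma)\mapsto\gamma$. -/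

import Mathlib

noncomputable section

namespace ReflectionTrick

open scoped Classical

/-! ### Simplicial complexes, geometric realizations, triangulations -/

section Complexes

variable {V V' V'' : Type*}

/-- A flag complex: every nonempty finite set of vertices that are pairwise joined by edges
spans a simplex. -/
def IsFlag (K : AbstractSimplicialComplex V) : Prop :=
  ∀ s : Finset V, s.Nonempty → (∀ i ∈ s, ∀ j ∈ s, {i, j} ∈ K.faces) → s ∈ K.faces

/-- Finite dimensionality: the number of vertices of the simplices is bounded. -/
def IsFiniteDimensional (K : AbstractSimplicialComplex V) : Prop :=
  ∃ d : ℕ, ∀ s ∈ K.faces, s.card ≤ d + 1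

/-- The points of the geometric realization, given by their barycentric coordinates. -/
@[ext]
structure Realization (K : AbstractSimplicialComplex V) where
  coord : V →₀ ℝ
  support_mem : coord.support ∈ K.faces
  nonneg : ∀ i, 0 ≤ coord i
  sum_eq_one : (coord.sum fun _ t => t) = 1

/-- Simplicial maps between abstract simplicial complexes. -/
def IsSimplicialMap (K : AbstractSimplicialComplex V) (L : AbstractSimplicialComplex V')
    (q : V → V') : Prop :=
  ∀ s ∈ K.faces, s.image q ∈ L.faces

theorem support_mapDomain (q : V → V') (x : V →₀ ℝ) (hx : ∀ i, 0 ≤ x i) :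
    (x.mapDomain q).support = x.support.image q := by
  apply Finset.Subset.antisymm Finsupp.mapDomain_support
  intro j hj
  obtain ⟨i, hi, rfl⟩ := Finset.mem_image.1 hj
  rw [Finsupp.mem_support_iff, Finsupp.mapDomain, Finsupp.sum_apply, Finsupp.sum]
  have hpos : 0 < x i := lt_of_le_of_ne (hx i) (Ne.symm (Finsupp.mem_support_iff.1 hi))
  refine (lt_of_lt_of_le hpos ?_).ne'
  have h1 : (Finsupp.single (q i) (x i)) (q i) = x i := by simp
  calc x i = (Finsupp.single (q i) (x i)) (q i) := h1.symm
    _ ≤ _ := Finset.single_le_sum (f := fun a => (Finsupp.single (q a) (x a)) (q i))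
      (fun a _ => by
        simp only [Finsupp.single_apply]
        split_ifs
        · exact hx a
        · exact le_rfl) hi

theorem mapDomain_nonneg (q : V → V') (x : V →₀ ℝ) (hx : ∀ i, 0 ≤ x i) (j : V') :
    0 ≤ x.mapDomain q j := by
  rw [Finsupp.mapDomain, Finsupp.sum_apply, Finsupp.sum]
  refine Finset.sum_nonneg fun a _ => ?_
  simp only [Finsupp.single_apply]
  split_ifs
  · exact hx a
  · exact le_rfl

/-- The map of realizations that is induced by a simplicial map (it is affine on simplices). -/
def Realization.map {K : AbstractSimplicialComplex V} {L : AbstractSimplicialComplex V'}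
    (q : V → V') (hq : IsSimplicialMap K L q) (x : Realization K) : Realization L where
  coord := x.coord.mapDomain q
  support_mem := by
    rw [support_mapDomain q _ x.nonneg]
    exact hq _ x.support_mem
  nonneg := mapDomain_nonneg q _ x.nonneg
  sum_eq_one := by
    rw [Finsupp.sum_mapDomain_index (fun _ => rfl) (fun _ _ _ => rfl)]
    exact x.sum_eq_one

/-- The inclusion of the closed simplex spanned by a face `s`. -/
def faceMap (K : AbstractSimplicialComplex V) (s : K.faces) (z : stdSimplex ℝ s.1) :
    Realization K where
  coord := (Finsupp.equivFunOnFinite.symm (z : s.1 → ℝ)).mapDomain Subtype.val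
  support_mem := by
    rw [support_mapDomain _ _ z.2.1]
    refine (K.isRelLowerSet_faces s.2).2 ?_ ?_
    · intro i hi
      obtain ⟨j, -, rfl⟩ := Finset.mem_image.1 hi
      exact j.2
    · rw [Finset.image_nonempty, Finsupp.support_nonempty_iff]
      intro h0
      have h1 := z.2.2
      have h2 : ∀ i, z.1 i = 0 := fun i => DFunLike.congr_fun h0 i
      simp [h2] at h1
  nonneg := mapDomain_nonneg _ _ z.2.1
  sum_eq_one := by
    rw [Finsupp.sum_mapDomain_index (fun _ => rfl) (fun _ _ _ => rfl),
      Finsupp.sum_fintype _ _ (fun _ => rfl)]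
    exact z.2.2

/-- The weak topology: a set is open iff its intersection with every closed simplex is. -/
instance (K : AbstractSimplicialComplex V) : TopologicalSpace (Realization K) :=
  ⨆ s : K.faces, TopologicalSpace.coinduced (faceMap K s) inferInstance

theorem continuous_faceMap (K : AbstractSimplicialComplex V) (s : K.faces) :
    Continuous (faceMap K s) :=
  continuous_iff_coinduced_le.2
    (le_iSup (fun s : K.faces => TopologicalSpace.coinduced (faceMap K s) inferInstance) s)

/-- The barycenter of a simplex, in barycentric coordinates. -/
def barycenter (s : Finset V) : V →₀ ℝ := ∑ j ∈ s, Finsupp.single j ((s.card : ℝ)⁻¹)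

/-- The simplices of the barycentric subdivision: finite chains of simplices. -/
def IsSdSimplex (K : AbstractSimplicialComplex V) (c : Finset (Finset V)) : Prop :=
  c.Nonempty ∧ (∀ s ∈ c, s ∈ K.faces) ∧ IsChain (· ⊆ ·) (c : Set (Finset V))

/-- The closed star of the vertex `i` in the barycentric subdivision: the union of all simplices
of the subdivision having the vertex `{i}`. -/
def closedStar (K : AbstractSimplicialComplex V) (i : V) : Set (Realization K) :=
  {x | ∃ c, IsSdSimplex K c ∧ {i} ∈ c ∧
    x.coord ∈ convexHull ℝ (barycenter '' (c : Set (Finset V)))}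

/-- The group of automorphisms of a simplicial complex. -/
def autGroup (K : AbstractSimplicialComplex V) : Subgroup (Equiv.Perm V) where
  carrier := {π | ∀ s : Finset V, s.image π ∈ K.faces ↔ s ∈ K.faces}
  one_mem' := by
    intro s
    simp
  mul_mem' := by
    intro a b ha hb s
    rw [← hb s, ← ha (s.image b), Finset.image_image]
    rfl
  inv_mem' := by
    intro a ha s
    rw [← ha (s.image _), Finset.image_image]
    simp

theorem autGroup_isSimplicialMap {K : AbstractSimplicialComplex V} (π : autGroup K) :
    IsSimplicialMap K K π.1 :=
  fun s hs => (π.2 s).2 hs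

/-- A triangulation of the subspace `N`. -/
structure Triangulation (V : Type*) {X : Type*} [TopologicalSpace X] (N : Set X) where
  complex : AbstractSimplicialComplex V
  homeo : Realization complex ≃ₜ N

variable {X : Type*} [TopologicalSpace X] {N : Set X}

/-- The map `f` restricts to a simplicial automorphism of the triangulated subspace `N`. -/
def Triangulation.IsSimplicial (T : Triangulation V N) (f : X → X) : Prop :=
  ∃ π : autGroup T.complex, ∀ x : Realization T.complex,
    f (T.homeo x) = T.homeo (x.map π.1 (autGroup_isSimplicialMap π))

/-- The triangulation `T'` of the preimage of `N` under `p` is lifted from the triangulation `T`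
of `N`: with respect to `T'` and `T` the map `p` is simplicial, and it is injective on each
simplex. -/
def Triangulation.IsLift {Y : Type*} [TopologicalSpace Y] {p : Y → X}
    (T' : Triangulation V' (p ⁻¹' N)) (T : Triangulation V N) : Prop :=
  ∃ (q : V' → V) (hq : IsSimplicialMap T'.complex T.complex q),
    (∀ s ∈ T'.complex.faces, Set.InjOn q s) ∧
    ∀ x : Realization T'.complex, p (T'.homeo x) = T.homeo (x.map q hq)

end Complexes

/-! ### The right-angled Coxeter group of a simplicial complex -/

section Coxeter

variable {V : Type*} (K : AbstractSimplicialComplex V)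

/-- `m i i = 1`, and for `i ≠ j`, `m i j = 2` if `{i, j}` is an edge and `m i j = ∞` (encoded
by `0`) otherwise. -/
def coxeterMatrix : CoxeterMatrix V where
  M := fun i j => if i = j then 1 else if {i, j} ∈ K.faces then 2 else 0
  isSymm := by
    ext i j
    change (if j = i then 1 else if {j, i} ∈ K.faces then 2 else 0) =
      if i = j then 1 else if {i, j} ∈ K.faces then 2 else 0
    simp only [eq_comm (a := j), Finset.pair_comm j]
  diagonal i := by simp
  off_diagonal i j h := by
    simp only [h, if_false]
    split_ifs <;> decide

/-- The right-angled Coxeter group with one generator for every vertex, where the generators of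
adjacent vertices commute. -/
abbrev CoxGroup : Type _ := (coxeterMatrix K).Group

/-- The generator of the Coxeter group at the vertex `i`. -/
abbrev gen (i : V) : CoxGroup K := (coxeterMatrix K).simple i

theorem isLiftable_aut (π : autGroup K) :
    (coxeterMatrix K).IsLiftable fun i => gen K (π.1 i) := by
  intro i j
  have h : (coxeterMatrix K) i j = (coxeterMatrix K) (π.1 i) (π.1 j) := by
    have h1 := π.2 {i, j}
    rw [Finset.image_insert, Finset.image_singleton] at h1
    simp only [coxeterMatrix, h1, EmbeddingLike.apply_eq_iff_eq]
  rw [h]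
  exact (coxeterMatrix K).toCoxeterSystem.simple_mul_simple_pow (π.1 i) (π.1 j)

/-- The endomorphism of the Coxeter group with `s_i ↦ s_{π i}`. -/
def coxeterMap (π : autGroup K) : CoxGroup K →* CoxGroup K :=
  (coxeterMatrix K).toCoxeterSystem.lift ⟨_, isLiftable_aut K π⟩

theorem coxeterMap_gen (π : autGroup K) (i : V) : coxeterMap K π (gen K i) = gen K (π.1 i) :=
  (coxeterMatrix K).toCoxeterSystem.lift_apply_simple (isLiftable_aut K π) i

theorem coxeterMap_mul (π ρ : autGroup K) :
    coxeterMap K (π * ρ) = (coxeterMap K π).comp (coxeterMap K ρ) := by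
  refine (coxeterMatrix K).toCoxeterSystem.ext_simple fun i => ?_
  change coxeterMap K (π * ρ) (gen K i) = coxeterMap K π (coxeterMap K ρ (gen K i))
  simp only [coxeterMap_gen]
  rfl

theorem coxeterMap_one : coxeterMap K 1 = MonoidHom.id _ := by
  refine (coxeterMatrix K).toCoxeterSystem.ext_simple fun i => ?_
  change coxeterMap K 1 (gen K i) = gen K i
  simp only [coxeterMap_gen]
  rfl

/-- The automorphisms of the complex act on the Coxeter group by permuting the generators. -/
def coxeterAut : autGroup K →* MulAut (CoxGroup K) where
  toFun π :=
    { coxeterMap K π with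
      invFun := coxeterMap K π⁻¹
      left_inv := fun w => by
        have h := DFunLike.congr_fun (coxeterMap_mul K π⁻¹ π) w
        rw [inv_mul_cancel, coxeterMap_one] at h
        exact h.symm
      right_inv := fun w => by
        have h := DFunLike.congr_fun (coxeterMap_mul K π π⁻¹) w
        rw [mul_inv_cancel, coxeterMap_one] at h
        exact h.symm }
  map_one' := MulEquiv.ext fun w => DFunLike.congr_fun (coxeterMap_one K) w
  map_mul' π ρ := MulEquiv.ext fun w => DFunLike.congr_fun (coxeterMap_mul K π ρ) w

theorem coxeterAut_gen (π : autGroup K) (i : V) :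
    coxeterAut K π (gen K i) = gen K (π.1 i) :=
  coxeterMap_gen K π i

end Coxeter

/-! ### The equivariant reflection group trick -/

section Vertices

variable {V : Type*}

/-- The point of the realization given by a vertex. -/
def vertexPoint (K : AbstractSimplicialComplex V) (i : V) : Realization K where
  coord := Finsupp.single i 1
  support_mem := by
    rw [show (Finsupp.single i (1 : ℝ)).support = {i} by simp [Finsupp.support_single]]
    exact K.singleton_mem i
  nonneg := fun j => by
    rw [Finsupp.single_apply]
    split_ifs <;> norm_num
  sum_eq_one := by simp

theorem vertexPoint_injective (K : AbstractSimplicialComplex V) :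
    Function.Injective (vertexPoint K) := fun _ _ h =>
  Finsupp.single_left_injective (one_ne_zero (α := ℝ)) (congrArg Realization.coord h)

theorem map_vertexPoint {V' : Type*} {K : AbstractSimplicialComplex V}
    {L : AbstractSimplicialComplex V'} (q : V → V') (hq : IsSimplicialMap K L q) (i : V) :
    (vertexPoint K i).map q hq = vertexPoint L (q i) := by
  ext1
  exact Finsupp.mapDomain_single

theorem barycenter_image (π : Equiv.Perm V) (s : Finset V) :
    (barycenter s).mapDomain π = barycenter (s.image π) := by
  rw [barycenter, barycenter, Finset.card_image_of_injective _ π.injective,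
    Finset.sum_image (fun a _ b _ h => π.injective h), Finsupp.mapDomain_finsetSum]
  simp only [Finsupp.mapDomain_single]

theorem map_mem_closedStar {K : AbstractSimplicialComplex V} (π : autGroup K) (i : V)
    {x : Realization K} (hx : x ∈ closedStar K i) :
    x.map π.1 (autGroup_isSimplicialMap π) ∈ closedStar K (π.1 i) := by
  obtain ⟨c, ⟨hne, hc, hchain⟩, hic, hxc⟩ := hx
  refine ⟨c.image (fun s => s.image π.1), ⟨hne.image _, ?_, ?_⟩, ?_, ?_⟩
  · intro t ht
    obtain ⟨s, hs, rfl⟩ := Finset.mem_image.1 ht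
    exact (π.2 s).2 (hc s hs)
  · intro t ht t' ht' hne'
    obtain ⟨s, hs, rfl⟩ := Finset.mem_image.1 (Finset.mem_coe.1 ht)
    obtain ⟨s', hs', rfl⟩ := Finset.mem_image.1 (Finset.mem_coe.1 ht')
    have hss : s ≠ s' := fun h => hne' (by rw [h])
    exact (hchain hs hs' hss).imp (fun h => Finset.image_subset_image h)
      (fun h => Finset.image_subset_image h)
  · exact Finset.mem_image.2 ⟨{i}, hic, Finset.image_singleton _ _⟩
  · have h := Set.mem_image_of_mem (Finsupp.lmapDomain ℝ ℝ (π.1 : V → V)) hxc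
    rw [LinearMap.image_convexHull, Set.image_image] at h
    simp only [Finsupp.lmapDomain_apply, barycenter_image] at h
    rw [Finset.coe_image, Set.image_image]
    exact h

end Vertices

/-- The input of the construction: a space `X`, a triangulated subspace `N`, and an action of the
group `G` on `X` by homeomorphisms that restrict to simplicial automorphisms of `N`. -/
structure Datum (V X G : Type*) [TopologicalSpace X] [Group G] where
  N : Set X
  tri : Triangulation V N
  act : G →* (X ≃ₜ X)
  simplicial : ∀ g, tri.IsSimplicial (act g)

namespace Datum

variable {V X G : Type*} [TopologicalSpace X] [Group G] (D : Datum V X G)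

/-- The automorphism of the complex by which a group element acts. -/
def aut (g : G) : autGroup D.tri.complex := (D.simplicial g).choose

theorem act_homeo (g : G) (x : Realization D.tri.complex) :
    D.act g (D.tri.homeo x) =
      D.tri.homeo (x.map (D.aut g).1 (autGroup_isSimplicialMap (D.aut g))) :=
  (D.simplicial g).choose_spec x

theorem aut_unique {g : G} {j i : V}
    (h : D.act g (D.tri.homeo (vertexPoint _ i)) = D.tri.homeo (vertexPoint _ j)) :
    (D.aut g).1 i = j := by
  rw [act_homeo, map_vertexPoint] at h
  exact vertexPoint_injective _ (D.tri.homeo.injective (Subtype.ext h))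

/-- The group acts on the complex by automorphisms. -/
def autHom : G →* autGroup D.tri.complex where
  toFun := D.aut
  map_one' := by
    refine Subtype.ext (Equiv.ext fun i => D.aut_unique ?_)
    rw [map_one]
    rfl
  map_mul' g h := by
    refine Subtype.ext (Equiv.ext fun i => D.aut_unique ?_)
    rw [map_mul, Homeomorph.mul_apply, act_homeo, map_vertexPoint, act_homeo, map_vertexPoint]
    rfl

/-- The right-angled Coxeter group `W`. -/
abbrev W : Type _ := CoxGroup D.tri.complex

/-- The action of `G` on `W`, written `w ^ g` in the semidirect product. -/
def φ : G →* MulAut D.W := (coxeterAut D.tri.complex).comp D.autHom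

/-- The semidirect product `W ⋊ G`. -/
abbrev WG : Type _ := D.W ⋊[D.φ] G

/-- The set `σ(x)` of the vertices `i` such that `x` lies in the closed star of `i` in the
barycentric subdivision of `N`; it is empty if `x` is not in `N`. -/
def sigma (x : X) : Set V := {i | x ∈ (fun y => (D.tri.homeo y : X)) '' closedStar D.tri.complex i}

/-- The special subgroup `W_x`, generated by the `s_i` with `i ∈ σ(x)`. -/
def special (x : X) : Subgroup D.W := Subgroup.closure (gen D.tri.complex '' D.sigma x)

theorem sigma_act (g : G) (x : X) {i : V} (hi : i ∈ D.sigma x) :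
    (D.aut g).1 i ∈ D.sigma (D.act g x) := by
  obtain ⟨y, hy, rfl⟩ := hi
  exact ⟨_, map_mem_closedStar _ _ hy, (D.act_homeo g y).symm⟩

theorem special_act (g : G) (x : X) {w : D.W} (hw : w ∈ D.special x) :
    D.φ g w ∈ D.special (D.act g x) := by
  have h : D.special x ≤ (D.special (D.act g x)).comap (D.φ g).toMonoidHom := by
    rw [special, Subgroup.closure_le]
    rintro _ ⟨i, hi, rfl⟩
    refine Subgroup.subset_closure ⟨(D.aut g).1 i, D.sigma_act g x hi, ?_⟩
    exact (coxeterAut_gen _ _ _).symm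
  exact h hw

/-- `(w, x) ∼ (w', x')` iff `x = x'` and `w⁻¹ w' ∈ W_x`. -/
def setoid : Setoid (D.W × X) where
  r a b := a.2 = b.2 ∧ a.1⁻¹ * b.1 ∈ D.special a.2
  iseqv :=
    { refl := fun a => ⟨rfl, by rw [inv_mul_cancel]; exact one_mem _⟩
      symm := fun {a b} h => ⟨h.1.symm, by
        have := inv_mem h.2
        rwa [mul_inv_rev, inv_inv, h.1] at this⟩
      trans := fun {a b c} h h' => ⟨h.1.trans h'.1, by
        have h2 := h'.2
        rw [← h.1] at h2
        have := mul_mem h.2 h2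
        rwa [mul_assoc, mul_inv_cancel_left] at this⟩ }

/-- The space `𝒰(X, N, G) = W × X / ∼`. -/
def U : Type _ := Quotient D.setoid

/-- The point `[w, x]`. -/
def point (w : D.W) (x : X) : D.U := Quotient.mk D.setoid (w, x)

/-- The quotient topology, where `W` is discrete. -/
instance : TopologicalSpace D.U :=
  ⨆ w : D.W, TopologicalSpace.coinduced (D.point w) inferInstance

/-- The action `(v, g) • [w, x] = [v w ^ g, g x]`. -/
instance : MulAction D.WG D.U where
  smul a := Quotient.map (fun b => (a.left * D.φ a.right b.1, D.act a.right b.2)) (by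
    rintro ⟨w, x⟩ ⟨w', x'⟩ ⟨h1, h2⟩
    dsimp only at h1 h2
    subst h1
    refine ⟨rfl, ?_⟩
    have h := D.special_act a.right x h2
    rw [map_mul, map_inv] at h
    dsimp only
    rwa [mul_inv_rev, mul_assoc, inv_mul_cancel_left])
  one_smul u := by
    induction u using Quotient.inductionOn with
    | h b =>
      change Quotient.mk _ _ = Quotient.mk _ _
      congr 1
      ext <;> simp
  mul_smul a a' u := by
    induction u using Quotient.inductionOn with
    | h b =>
      change Quotient.mk _ _ = Quotient.mk _ _
      congr 1
      ext <;> simp [mul_assoc]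

theorem smul_point (v : D.W) (g : G) (w : D.W) (x : X) :
    (⟨v, g⟩ : D.WG) • D.point w x = D.point (v * D.φ g w) (D.act g x) :=
  rfl

/-- The stabilizer `G_x` in `G` of the point `x`. -/
def stab (x : X) : Subgroup G where
  carrier := {g | D.act g x = x}
  one_mem' := by
    change D.act 1 x = x
    rw [map_one]
    rfl
  mul_mem' := by
    intro a b ha hb
    change D.act (a * b) x = x
    rw [map_mul, Homeomorph.mul_apply, hb, ha]
  inv_mem' := by
    intro a ha
    change D.act a⁻¹ x = x
    rw [map_inv, Homeomorph.inv_apply, Homeomorph.symm_apply_eq]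
    exact ha.symm

end Datum

/-! ### Lifting a group action to a covering space -/

section Lifting

variable {X Y : Type*} [TopologicalSpace X] [TopologicalSpace Y]

/-- The group of all homeomorphisms of `Y` that are lifts along `p` of elements of `C`. -/
def liftGroup (p : Y → X) (C : Subgroup (X ≃ₜ X)) : Subgroup (Y ≃ₜ Y) where
  carrier := {γ | ∃ g ∈ C, ∀ y, p (γ y) = g (p y)}
  one_mem' := ⟨1, C.one_mem, fun _ => rfl⟩
  mul_mem' := by
    rintro a b ⟨g, hg, hga⟩ ⟨h, hh, hhb⟩
    exact ⟨g * h, C.mul_mem hg hh, fun y => by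
      rw [Homeomorph.mul_apply, hga, hhb, Homeomorph.mul_apply]⟩
  inv_mem' := by
    rintro a ⟨g, hg, hga⟩
    refine ⟨g⁻¹, C.inv_mem hg, fun y => ?_⟩
    rw [Homeomorph.inv_apply, Homeomorph.inv_apply, eq_comm, Homeomorph.symm_apply_eq, ← hga,
      Homeomorph.apply_symm_apply]

variable {V V' : Type*} {N : Set X}

theorem isSimplicial_inv {T : Triangulation V N} {g : X ≃ₜ X} (hg : T.IsSimplicial g) :
    T.IsSimplicial (g⁻¹ : X ≃ₜ X) := by
  obtain ⟨π, hπ⟩ := hg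
  refine ⟨π⁻¹, fun x => ?_⟩
  rw [Homeomorph.inv_apply, Homeomorph.symm_apply_eq, hπ]
  congr 2
  ext1
  simp only [Realization.map]
  rw [← Finsupp.mapDomain_comp]
  have h : (⇑π.1 ∘ ⇑(π⁻¹).1 : V → V) = id := by
    funext i
    simp
  rw [h, Finsupp.mapDomain_id]

theorem isSimplicial_of_mem_zpowers {T : Triangulation V N} {ω : X ≃ₜ X}
    (hω : T.IsSimplicial ω) {g : X ≃ₜ X} (hg : g ∈ Subgroup.zpowers ω) : T.IsSimplicial g := by
  rw [Subgroup.zpowers_eq_closure] at hg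
  induction hg using Subgroup.closure_induction with
  | mem g hg => rwa [Set.mem_singleton_iff.1 hg]
  | one =>
    refine ⟨1, fun x => ?_⟩
    rw [Homeomorph.one_apply]
    congr 2
    ext1
    exact Finsupp.mapDomain_id.symm
  | mul a b _ _ ha hb =>
    obtain ⟨π, hπ⟩ := ha
    obtain ⟨ρ, hρ⟩ := hb
    refine ⟨π * ρ, fun x => ?_⟩
    rw [Homeomorph.mul_apply, hρ, hπ]
    congr 2
    ext1
    exact Finsupp.mapDomain_comp.symm
  | inv a _ ha => exact isSimplicial_inv ha

/-- The barycenter of a simplex, as a point of the realization. -/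
theorem exists_support_eq (K : AbstractSimplicialComplex V) (s : K.faces) :
    ∃ z : stdSimplex ℝ s.1, (faceMap K s z).coord.support = s.1 := by
  have hs : s.1.Nonempty := (K.isRelLowerSet_faces s.2).1
  have : Nonempty s.1 := hs.to_subtype
  have hc : (0 : ℝ) < (Fintype.card s.1 : ℝ)⁻¹ := inv_pos.2 (Nat.cast_pos.2 Fintype.card_pos)
  refine ⟨⟨fun _ => (Fintype.card s.1 : ℝ)⁻¹, fun _ => hc.le, ?_⟩, ?_⟩
  · rw [Finset.sum_const, Finset.card_univ, nsmul_eq_mul]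
    exact mul_inv_cancel₀ (inv_pos.1 hc).ne'
  · rw [faceMap, support_mapDomain _ _ (fun _ => hc.le)]
    ext i
    simp only [Finset.mem_image, Finsupp.mem_support_iff]
    exact ⟨fun ⟨j, _, h⟩ => h ▸ j.2, fun h => ⟨⟨i, h⟩, hc.ne', rfl⟩⟩

theorem exists_faceMap (K : AbstractSimplicialComplex V) (s : K.faces) (x : Realization K)
    (hx : x.coord.support ⊆ s.1) : ∃ z, faceMap K s z = x := by
  refine ⟨⟨fun i => x.coord i.1, fun i => x.nonneg i.1, ?_⟩, ?_⟩
  · rw [Finset.sum_coe_sort s.1 (fun i => x.coord i), ← x.sum_eq_one]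
    exact (Finsupp.sum_of_support_subset x.coord hx (fun _ t => t) (fun _ _ => rfl)).symm
  · ext i
    by_cases hi : i ∈ s.1
    · exact Finsupp.mapDomain_apply Subtype.val_injective _ (⟨i, hi⟩ : s.1)
    · have h1 : x.coord i = 0 := by
        by_contra h
        exact hi (hx (Finsupp.mem_support_iff.2 h))
      rw [h1]
      exact Finsupp.mapDomain_of_notMem_range _ _ (by simpa using hi)

/-- On each simplex, a lift of a simplicial homeomorphism is given by a map of vertices. -/
theorem lift_on_face {p : Y → X} (hp : IsCoveringMap p) {T : Triangulation V N}
    {T' : Triangulation V' (p ⁻¹' N)} (hT : T'.IsLift T) {g : X ≃ₜ X} (hg : T.IsSimplicial g)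
    {γ : Y ≃ₜ Y} (hγ : ∀ y, p (γ y) = g (p y)) (s : T'.complex.faces) :
    ∃ f : V' → V', s.1.image f ∈ T'.complex.faces ∧
      ∀ x : Realization T'.complex, x.coord.support ⊆ s.1 →
        ∃ x' : Realization T'.complex, x'.coord = x.coord.mapDomain f ∧
          γ (T'.homeo x) = T'.homeo x' := by
  obtain ⟨q, hq, hinj, hpq⟩ := hT
  obtain ⟨π, hπ⟩ := hg
  have hs : s.1.Nonempty := (T'.complex.isRelLowerSet_faces s.2).1
  have : Nonempty s.1 := hs.to_subtype
  obtain ⟨z₀, hz₀⟩ := exists_support_eq T'.complex s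
  have hgp : ∀ x : Realization T'.complex, p (γ (T'.homeo x)) =
      T.homeo ((x.map q hq).map π.1 (autGroup_isSimplicialMap π)) := fun x => by
    rw [hγ, hpq, hπ]
  have hmem : γ (T'.homeo (faceMap _ s z₀)) ∈ p ⁻¹' N := by
    rw [Set.mem_preimage, hgp]
    exact Subtype.coe_prop _
  obtain ⟨x', hx'⟩ := T'.homeo.surjective ⟨_, hmem⟩
  have hx'' : (T'.homeo x' : Y) = γ (T'.homeo (faceMap _ s z₀)) := congrArg Subtype.val hx'
  have hcoord : x'.coord.mapDomain q =
      ((faceMap _ s z₀).coord.mapDomain q).mapDomain π.1 := by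
    have h := hgp (faceMap _ s z₀)
    rw [← hx'', hpq] at h
    exact congrArg Realization.coord (T.homeo.injective (Subtype.ext h))
  have hsupp : x'.coord.support.image q = (s.1.image q).image π.1 := by
    have h := congrArg Finsupp.support hcoord
    rwa [support_mapDomain _ _ x'.nonneg,
      support_mapDomain _ _ (mapDomain_nonneg _ _ (Realization.nonneg _)),
      support_mapDomain _ _ (Realization.nonneg _), hz₀] at h
  set t : T'.complex.faces := ⟨x'.coord.support, x'.support_mem⟩ with ht
  have hex : ∀ i : s.1, ∃ j : t.1, q j.1 = π.1 (q i.1) := fun i => by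
    have h : π.1 (q i.1) ∈ x'.coord.support.image q := by
      rw [hsupp]
      exact Finset.mem_image_of_mem _ (Finset.mem_image_of_mem _ i.2)
    obtain ⟨j, hj, hj'⟩ := Finset.mem_image.1 h
    exact ⟨⟨j, hj⟩, hj'⟩
  choose e he using hex
  set f : V' → V' := fun i => if h : i ∈ s.1 then (e ⟨i, h⟩).1 else i with hf
  have hfe : ∀ i : s.1, f i.1 = (e i).1 := fun i => by simp [hf]
  have hfq : ∀ i ∈ s.1, q (f i) = π.1 (q i) := fun i hi => by
    rw [hfe ⟨i, hi⟩, he]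
  have hft : s.1.image f ⊆ t.1 := by
    intro j hj
    obtain ⟨i, hi, rfl⟩ := Finset.mem_image.1 hj
    rw [hfe ⟨i, hi⟩]
    exact (e _).2
  have hmap : ∀ z : stdSimplex ℝ s.1, (faceMap T'.complex t (stdSimplex.map e z)).coord =
      (faceMap T'.complex s z).coord.mapDomain f := fun z => by
    simp only [faceMap]
    rw [← Finsupp.mapDomain_comp]
    have h1 : (f ∘ Subtype.val : s.1 → V') = Subtype.val ∘ e := funext hfe
    rw [h1, Finsupp.mapDomain_comp]
    congr 1
    ext j
    rfl
  have hkey : (fun z => γ (T'.homeo (faceMap _ s z))) =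
      fun z => (T'.homeo (faceMap _ t (stdSimplex.map e z)) : Y) := by
    refine hp.eq_of_comp_eq ?_ ?_ ?_ z₀ ?_
    · exact γ.continuous.comp (continuous_subtype_val.comp
        (T'.homeo.continuous.comp (continuous_faceMap _ s)))
    · exact continuous_subtype_val.comp (T'.homeo.continuous.comp
        ((continuous_faceMap _ t).comp (stdSimplex.continuous_map e)))
    · funext z
      simp only [Function.comp_apply]
      rw [hgp, hpq]
      congr 2
      ext1
      simp only [Realization.map, hmap]
      rw [← Finsupp.mapDomain_comp, ← Finsupp.mapDomain_comp]
      refine Finsupp.mapDomain_congr fun i hi => ?_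
      have his : i ∈ s.1 := by
        have h := support_mapDomain (Subtype.val : s.1 → V')
          (Finsupp.equivFunOnFinite.symm (z : s.1 → ℝ)) z.2.1
        have hi' : i ∈ (Finsupp.mapDomain (Subtype.val : s.1 → V')
          (Finsupp.equivFunOnFinite.symm (z : s.1 → ℝ))).support := hi
        rw [h] at hi'
        obtain ⟨j, -, rfl⟩ := Finset.mem_image.1 hi'
        exact j.2
      exact (hfq i his).symm
    · rw [← hx'']
      congr 2
      ext1
      rw [hmap]
      refine Finsupp.mapDomain_injOn (t.1 : Set V') (hinj _ t.2) ?_ ?_ ?_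
      · exact fun _ h => h
      · intro i hi
        have := Finsupp.mapDomain_support hi
        rw [hz₀] at this
        exact hft this
      · rw [hcoord, ← Finsupp.mapDomain_comp, ← Finsupp.mapDomain_comp]
        refine Finsupp.mapDomain_congr fun i hi => ?_
        rw [hz₀] at hi
        exact (hfq i hi).symm
  refine ⟨f, (T'.complex.isRelLowerSet_faces t.2).2 hft (hs.image _), fun x hx => ?_⟩
  obtain ⟨z, rfl⟩ := exists_faceMap _ s x hx
  exact ⟨_, hmap z, congrFun hkey z⟩

theorem isSimplicial_lift {p : Y → X} (hp : IsCoveringMap p) {T : Triangulation V N}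
    {T' : Triangulation V' (p ⁻¹' N)} (hT : T'.IsLift T) {g : X ≃ₜ X} (hg : T.IsSimplicial g)
    {γ : Y ≃ₜ Y} (hγ : ∀ y, p (γ y) = g (p y)) : T'.IsSimplicial γ := by
  have main : ∀ (g : X ≃ₜ X) (γ : Y ≃ₜ Y), T.IsSimplicial g → (∀ y, p (γ y) = g (p y)) →
      ∃ f : V' → V', IsSimplicialMap T'.complex T'.complex f ∧
        ∀ x : Realization T'.complex, ∃ x' : Realization T'.complex,
          x'.coord = x.coord.mapDomain f ∧ γ (T'.homeo x) = T'.homeo x' := by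
    intro g γ hg hγ
    choose F hF hF' using lift_on_face hp hT hg hγ
    set f : V' → V' := fun i => F ⟨{i}, T'.complex.singleton_mem i⟩ i with hf
    have hfF : ∀ (s : T'.complex.faces), ∀ i ∈ s.1, F s i = f i := by
      intro s i hi
      have hsup : ∀ r : Finset V', i ∈ r → (vertexPoint T'.complex i).coord.support ⊆ r := by
        intro r hr
        refine Finsupp.support_single_subset.trans ?_
        simpa using hr
      obtain ⟨x, hx, hx'⟩ := hF' s (vertexPoint _ i) (hsup _ hi)
      obtain ⟨y, hy, hy'⟩ := hF' ⟨{i}, T'.complex.singleton_mem i⟩ (vertexPoint _ i)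
        (hsup _ (Finset.mem_singleton_self i))
      have hxy : x = y := T'.homeo.injective (Subtype.ext (hx'.symm.trans hy'))
      rw [hxy, hy] at hx
      simp only [vertexPoint, Finsupp.mapDomain_single] at hx
      exact (Finsupp.single_left_injective one_ne_zero hx).symm
    refine ⟨f, fun s hs => ?_, fun x => ?_⟩
    · rw [← Finset.image_congr (hfF ⟨s, hs⟩)]
      exact hF ⟨s, hs⟩
    · obtain ⟨x', h1, h2⟩ := hF' ⟨_, x.support_mem⟩ x (Finset.Subset.refl _)
      exact ⟨x', h1.trans (Finsupp.mapDomain_congr (hfF ⟨_, x.support_mem⟩)), h2⟩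
  obtain ⟨f, hf, hf'⟩ := main g γ hg hγ
  obtain ⟨k, hk, hk'⟩ := main g⁻¹ γ⁻¹ (isSimplicial_inv hg) (fun y => by
    rw [Homeomorph.inv_apply, Homeomorph.inv_apply, eq_comm, Homeomorph.symm_apply_eq, ← hγ,
      Homeomorph.apply_symm_apply])
  have hcomp : ∀ (γ₁ γ₂ : Y ≃ₜ Y) (f₁ f₂ : V' → V'), (∀ y, γ₂ (γ₁ y) = y) →
      (∀ x : Realization T'.complex, ∃ x' : Realization T'.complex,
          x'.coord = x.coord.mapDomain f₁ ∧ γ₁ (T'.homeo x) = T'.homeo x') →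
      (∀ x : Realization T'.complex, ∃ x' : Realization T'.complex,
          x'.coord = x.coord.mapDomain f₂ ∧ γ₂ (T'.homeo x) = T'.homeo x') →
      ∀ i, f₂ (f₁ i) = i := by
    intro γ₁ γ₂ f₁ f₂ hγ' h₁ h₂ i
    obtain ⟨x, hx, hx'⟩ := h₁ (vertexPoint _ i)
    obtain ⟨y, hy, hy'⟩ := h₂ x
    have hxy : vertexPoint _ i = y := T'.homeo.injective (Subtype.ext (by
      rw [← hy', ← hx', hγ']))
    rw [← hxy, hx] at hy
    simp only [vertexPoint, Finsupp.mapDomain_single] at hy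
    exact (Finsupp.single_left_injective one_ne_zero hy).symm
  let e : Equiv.Perm V' :=
    { toFun := f
      invFun := k
      left_inv := hcomp γ γ⁻¹ f k (fun y => γ.symm_apply_apply y) hf' hk'
      right_inv := hcomp γ⁻¹ γ k f (fun y => γ.apply_symm_apply y) hk' hf' }
  refine ⟨⟨e, fun s => ⟨fun h => ?_, hf s⟩⟩, fun x => ?_⟩
  · have h1 := hk _ h
    rw [Finset.image_image] at h1
    have h2 : k ∘ ⇑e = id := funext e.left_inv
    rwa [h2, Finset.image_id] at h1
  · obtain ⟨x', h1, h2⟩ := hf' x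
    rw [h2]
    congr 2
    ext1
    exact h1

/-- The datum for the reflection trick on the covering space: the triangulated preimage of `N`,
with the group of all lifts of the powers of `ω`. -/
def liftDatum {p : Y → X} (hp : IsCoveringMap p) {T : Triangulation V N} {ω : X ≃ₜ X}
    (hω : T.IsSimplicial ω) (T' : Triangulation V' (p ⁻¹' N)) (hT : T'.IsLift T) :
    Datum V' Y (liftGroup p (Subgroup.zpowers ω)) where
  N := p ⁻¹' N
  tri := T'
  act := (liftGroup p (Subgroup.zpowers ω)).subtype
  simplicial γ := by
    obtain ⟨g, hg, hγ⟩ := γ.2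
    exact isSimplicial_lift hp hT (isSimplicial_of_mem_zpowers hω hg) hγ

end Lifting

end ReflectionTrick

end

/-!
An element `(v, γ)` fixes `[w, x]` iff `γ` fixes `x` and `w⁻¹ v w ^ γ` lies in `W_x`. So the
projection to `γ` maps the stabilizer of `[w, x]` to `Γ_x` with kernel `w W_x w⁻¹`, and it is onto
because `(w (w ^ γ)⁻¹, γ)` fixes `[w, x]` for every `γ` in `Γ_x`. Both ends of this extension are
finite. A point in the closed star of `i` has a positive `i`-th barycentric coordinate, so the
generators of `W_x` belong to vertices of a single simplex and are commuting involutions. A lift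
that fixes `x` is determined by the homeomorphism it covers, by uniqueness of lifts to a connected
covering space.
-/

namespace ReflectionTrick

section Groups

theorem finite_closure_of_commute_of_isOfFinOrder {G : Type*} [Group G] {s : Set G}
    (hs : s.Finite) (hcomm : ∀ a ∈ s, ∀ b ∈ s, Commute a b) (hord : ∀ a ∈ s, IsOfFinOrder a) :
    Finite (Subgroup.closure s) := by
  have : IsMulCommutative (Subgroup.closure s) := Subgroup.isMulCommutative_closure hcomm
  have : Finite s := hs
  have : Group.FG (Subgroup.closure s) := Group.closure_finite_fg s
  have htorsion : ∀ a ∈ Subgroup.closure s, IsOfFinOrder a := fun a ha => by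
    induction ha using Subgroup.closure_induction with
    | mem a ha => exact hord a ha
    | one => exact IsOfFinOrder.one
    | mul a b ha hb iha ihb =>
      exact Commute.isOfFinOrder_mul (setLike_mul_comm ha hb) iha ihb
    | inv a _ iha => exact iha.inv
  open scoped IsMulCommutative in
  exact CommGroup.finite_of_fg_isMulTorsion _ fun a =>
    Submonoid.isOfFinOrder_coe.1 (htorsion a a.2)

variable {N E G : Type*} [Group N] [Group E] [Group G]

theorem card_eq_card_mul_card_of_groupExtension (S : GroupExtension N E G) :
    Nat.card E = Nat.card N * Nat.card G := by
  rw [← S.inl.range.card_mul_index, Subgroup.index_eq_card,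
    Nat.card_congr S.quotientRangeInlEquivRight.toEquiv,
    ← Nat.card_congr (MonoidHom.ofInjective S.inl_injective).toEquiv]

theorem finite_of_groupExtension [Finite N] [Finite G] (S : GroupExtension N E G) : Finite E :=
  Nat.finite_of_card_ne_zero <|
    (card_eq_card_mul_card_of_groupExtension S).trans_ne (mul_pos Nat.card_pos Nat.card_pos).ne'

theorem commute_simple_of_eq_two {B W : Type*} [Group W] {M : CoxeterMatrix B}
    (cs : CoxeterSystem M W) {i j : B} (h : M i j = 2) : Commute (cs.simple i) (cs.simple j) := by
  have hsq : cs.simple i * cs.simple j * (cs.simple i * cs.simple j) = 1 := by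
    rw [← sq, ← h, cs.simple_mul_simple_pow]
  rw [Commute, SemiconjBy, eq_inv_of_mul_eq_one_left hsq, mul_inv_rev, cs.inv_simple, cs.inv_simple]

end Groups

section Complexes

variable {V : Type*} {K : AbstractSimplicialComplex V}

theorem isOfFinOrder_gen (i : V) : IsOfFinOrder (gen K i) :=
  isOfFinOrder_iff_pow_eq_one.2 ⟨2, two_pos, (coxeterMatrix K).toCoxeterSystem.simple_sq i⟩

open Classical in
theorem commute_gen_of_pair_mem_faces {i j : V} (h : {i, j} ∈ K.faces) :
    Commute (gen K i) (gen K j) := by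
  rcases eq_or_ne i j with rfl | hij
  · exact Commute.refl _
  · have htwo : coxeterMatrix K i j = 2 := (if_neg hij).trans (if_pos h)
    exact commute_simple_of_eq_two (coxeterMatrix K).toCoxeterSystem htwo

theorem finite_closure_gen_of_subset_face {s : Finset V} (hs : s ∈ K.faces) {σ : Set V}
    (hσ : σ ⊆ s) : Finite (Subgroup.closure (gen K '' σ)) := by
  classical
  have hpair : ∀ i ∈ σ, ∀ j ∈ σ, {i, j} ∈ K.faces := fun i hi j hj =>
    (K.isRelLowerSet_faces hs).2
      (Finset.insert_subset (hσ hi) (Finset.singleton_subset_iff.2 (hσ hj)))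
      (Finset.insert_nonempty _ _)
  refine finite_closure_of_commute_of_isOfFinOrder ((s.finite_toSet.subset hσ).image _) ?_ ?_
  · rintro _ ⟨i, hi, rfl⟩ _ ⟨j, hj, rfl⟩
    exact commute_gen_of_pair_mem_faces (hpair i hi j hj)
  · rintro _ ⟨i, -, rfl⟩
    exact isOfFinOrder_gen i

theorem barycenter_apply_pos {s : Finset V} {i : V} (hi : i ∈ s) : 0 < barycenter s i := by
  classical
  rw [barycenter, Finsupp.finsetSum_apply]
  simp only [Finsupp.single_apply]
  rw [Finset.sum_ite_eq' s i, if_pos hi]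
  exact inv_pos.2 (Nat.cast_pos.2 (Finset.card_pos.2 ⟨i, hi⟩))

theorem IsSdSimplex.mem_of_singleton_mem {c : Finset (Finset V)} (hc : IsSdSimplex K c) {i : V}
    (hi : {i} ∈ c) {s : Finset V} (hs : s ∈ c) : i ∈ s := by
  rcases hc.2.2.total hi hs with h | h
  · exact Finset.singleton_subset_iff.1 h
  · have hne : s.Nonempty := (K.isRelLowerSet_faces (hc.2.1 s hs)).1
    exact hne.subset_singleton_iff.1 h ▸ Finset.mem_singleton_self i

theorem mem_support_of_mem_closedStar {i : V} {x : Realization K} (hx : x ∈ closedStar K i) :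
    i ∈ x.coord.support := by
  obtain ⟨c, hc, hi, hxc⟩ := hx
  have hpos : convexHull ℝ (barycenter '' (c : Set (Finset V))) ⊆ {z | 0 < z i} := by
    refine convexHull_min ?_ (convex_halfSpace_gt (Finsupp.lapply i : (V →₀ ℝ) →ₗ[ℝ] ℝ).isLinear 0)
    rintro _ ⟨s, hs, rfl⟩
    exact barycenter_apply_pos (hc.mem_of_singleton_mem hi hs)
  exact Finsupp.mem_support_iff.2 (hpos hxc).ne'

end Complexes

namespace Datum

variable {V X G : Type*} [TopologicalSpace X] [Group G] (D : Datum V X G)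

theorem sigma_homeo_subset_support (z : Realization D.tri.complex) :
    D.sigma (D.tri.homeo z) ⊆ z.coord.support := by
  rintro i ⟨y, hy, hyz⟩
  obtain rfl : y = z := D.tri.homeo.injective (Subtype.ext hyz)
  exact mem_support_of_mem_closedStar hy

theorem special_eq_bot {x : X} (hx : x ∉ D.N) : D.special x = ⊥ := by
  have hσ : D.sigma x = ∅ := by
    refine Set.eq_empty_of_forall_notMem ?_
    rintro i ⟨y, -, rfl⟩
    exact hx (D.tri.homeo y).2
  rw [special, hσ, Set.image_empty, Subgroup.closure_empty]

theorem finite_special (x : X) : Finite (D.special x) := by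
  by_cases hx : x ∈ D.N
  · obtain ⟨z, hz⟩ := D.tri.homeo.surjective ⟨x, hx⟩
    obtain rfl : (D.tri.homeo z : X) = x := congrArg Subtype.val hz
    exact finite_closure_gen_of_subset_face z.support_mem (D.sigma_homeo_subset_support z)
  · rw [D.special_eq_bot hx]
    infer_instance

theorem exists_point_eq (u : D.U) : ∃ w x, D.point w x = u := by
  obtain ⟨⟨w, x⟩, h⟩ := Quotient.exists_rep u
  exact ⟨w, x, h⟩

theorem point_eq_point_iff {w w' : D.W} {x x' : X} :
    D.point w x = D.point w' x' ↔ x = x' ∧ w⁻¹ * w' ∈ D.special x :=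
  Quotient.eq (r := D.setoid)

theorem mem_stabilizer_point {w : D.W} {x : X} {a : D.WG} :
    a ∈ MulAction.stabilizer D.WG (D.point w x) ↔
      a.right ∈ D.stab x ∧ w⁻¹ * (a.left * D.φ a.right w) ∈ D.special x := by
  rw [MulAction.mem_stabilizer_iff, eq_comm, smul_point, point_eq_point_iff, eq_comm]
  rfl

/-- The conjugation `v ↦ (w v w⁻¹, 1)`, which embeds `W_x` into the stabilizer of `[w, x]`. -/
noncomputable def specialToStabilizer (w : D.W) (x : X) :
    D.special x →* MulAction.stabilizer D.WG (D.point w x) :=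
  ((SemidirectProduct.inl.comp (MulAut.conj w).toMonoidHom).comp (D.special x).subtype).codRestrict
    _ fun v => D.mem_stabilizer_point.2 ⟨one_mem _, by simp [mul_assoc]⟩

/-- The projection `(v, g) ↦ g` from the stabilizer of `[w, x]` to the stabilizer `G_x`. -/
noncomputable def stabilizerToStab (w : D.W) (x : X) :
    MulAction.stabilizer D.WG (D.point w x) →* D.stab x :=
  (SemidirectProduct.rightHom.comp (Subgroup.subtype _)).codRestrict _ fun a =>
    (D.mem_stabilizer_point.1 a.2).1

theorem specialToStabilizer_injective (w : D.W) (x : X) :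
    Function.Injective (D.specialToStabilizer w x) := fun _ _ h =>
  Subtype.ext <| (MulAut.conj w).injective <|
    SemidirectProduct.inl_injective (congrArg Subtype.val h)

theorem range_specialToStabilizer (w : D.W) (x : X) :
    (D.specialToStabilizer w x).range = (D.stabilizerToStab w x).ker := by
  ext a
  constructor
  · rintro ⟨v, rfl⟩
    rfl
  · intro ha
    have hright : a.1.right = 1 := congrArg Subtype.val ha
    have hleft : w⁻¹ * (a.1.left * w) ∈ D.special x := by
      simpa only [hright, map_one, MulAut.one_apply] using (D.mem_stabilizer_point.1 a.2).2
    refine ⟨⟨_, hleft⟩, Subtype.ext (SemidirectProduct.ext ?_ hright.symm)⟩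
    change w * (w⁻¹ * (a.1.left * w)) * w⁻¹ = a.1.left
    group

theorem stabilizerToStab_surjective (w : D.W) (x : X) :
    Function.Surjective (D.stabilizerToStab w x) := fun g =>
  ⟨⟨⟨w * (D.φ g w)⁻¹, g⟩, D.mem_stabilizer_point.2 ⟨g.2, by simp⟩⟩, rfl⟩

/-- The short exact sequence `1 → W_x → Stab [w, x] → G_x → 1`. -/
noncomputable def stabilizerExtension (w : D.W) (x : X) :
    GroupExtension (D.special x) (MulAction.stabilizer D.WG (D.point w x)) (D.stab x) where
  inl := D.specialToStabilizer w x
  rightHom := D.stabilizerToStab w x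
  inl_injective := D.specialToStabilizer_injective w x
  range_inl_eq_ker_rightHom := D.range_specialToStabilizer w x
  rightHom_surjective := D.stabilizerToStab_surjective w x

theorem finite_stabilizer_point (w : D.W) (x : X) [Finite (D.stab x)] :
    Finite (MulAction.stabilizer D.WG (D.point w x)) :=
  have := D.finite_special x
  finite_of_groupExtension (D.stabilizerExtension w x)

theorem finite_of_forall_smul_eq [∀ x, Finite (D.stab x)] {H : Subgroup D.WG} {u : D.U}
    (hH : ∀ h ∈ H, h • u = u) : Finite H := by
  obtain ⟨w, x, rfl⟩ := D.exists_point_eq u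
  have hle : H ≤ MulAction.stabilizer D.WG (D.point w x) := hH
  have := D.finite_stabilizer_point w x
  exact Finite.of_injective _ (Subgroup.inclusion_injective hle)

theorem card_stabilizer_point {x : X} (hx : x ∉ D.N) (w : D.W) :
    Nat.card (MulAction.stabilizer D.WG (D.point w x)) = Nat.card (D.stab x) := by
  rw [card_eq_card_mul_card_of_groupExtension (D.stabilizerExtension w x), D.special_eq_bot hx,
    Subgroup.card_bot, one_mul]

end Datum

section Lifting

variable {X Y : Type*} [TopologicalSpace X] [TopologicalSpace Y] {p : Y → X}

/-- An element of `C` that is covered by `γ`. It is unique when `p` is surjective; in general this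
is a choice and not a homomorphism. -/
noncomputable def coveredElement {C : Subgroup (X ≃ₜ X)} (γ : liftGroup p C) : C :=
  ⟨γ.2.choose, γ.2.choose_spec.1⟩

theorem apply_liftGroup {C : Subgroup (X ≃ₜ X)} (γ : liftGroup p C) (y : Y) :
    p (γ.1 y) = (coveredElement γ).1 (p y) :=
  γ.2.choose_spec.2 y

variable [PreconnectedSpace Y]

theorem injOn_coveredElement (hp : IsCoveringMap p) (C : Subgroup (X ≃ₜ X)) (y z : Y) :
    Set.InjOn coveredElement {γ : liftGroup p C | γ.1 y = z} := by
  intro γ hγ γ' hγ' h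
  have hcover : p ∘ γ.1 = p ∘ γ'.1 := funext fun t => by
    rw [Function.comp_apply, Function.comp_apply, apply_liftGroup γ, apply_liftGroup γ', h]
  exact Subtype.ext <| DFunLike.coe_injective <|
    hp.eq_of_comp_eq γ.1.continuous γ'.1.continuous hcover y (hγ.trans hγ'.symm)

variable {V V' : Type*} {N : Set X} {T : Triangulation V N} {ω : X ≃ₜ X}
  {T' : Triangulation V' (p ⁻¹' N)}

theorem finite_stab_liftDatum (hp : IsCoveringMap p) (hω : T.IsSimplicial ω) (hT : T'.IsLift T)
    (hfin : IsOfFinOrder ω) (y : Y) : Finite ((liftDatum hp hω T' hT).stab y) :=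
  have : Finite (Subgroup.zpowers ω) := finite_zpowers.2 hfin
  Finite.of_injective _ (injOn_coveredElement hp _ y y).injective

theorem card_stab_liftDatum_le (hp : IsCoveringMap p) (hω : T.IsSimplicial ω) (hT : T'.IsLift T)
    (hfin : IsOfFinOrder ω) (y : Y) :
    Nat.card ((liftDatum hp hω T' hT).stab y) ≤ orderOf ω := by
  have : Finite (Subgroup.zpowers ω) := finite_zpowers.2 hfin
  rw [← Nat.card_zpowers]
  exact Nat.card_le_card_of_injective _ (injOn_coveredElement hp _ y y).injective

end Lifting

end ReflectionTrick

theorem mainTheorem6_general {V V' M M' : Type*} [TopologicalSpace M] [TopologicalSpace M']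
    [PreconnectedSpace M'] {p : M' → M} (hp : IsCoveringMap p)
    {N : Set M} {T : ReflectionTrick.Triangulation V N}
    {ω : M ≃ₜ M} {n : ℕ} (hn : 0 < n) (hωn : ω ^ n = 1) (hω : T.IsSimplicial ω)
    {T' : ReflectionTrick.Triangulation V' (p ⁻¹' N)} (hT' : T'.IsLift T) :
    let D := ReflectionTrick.liftDatum hp hω T' hT'
    (∀ (H : Subgroup D.WG) (u : D.U), (∀ h ∈ H, h • u = u) → Finite H) ∧
    (∀ (w : D.W) (x : M'), x ∉ p ⁻¹' N →
      Finite (MulAction.stabilizer D.WG (D.point w x)) ∧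
      Nat.card (MulAction.stabilizer D.WG (D.point w x)) ≤ n) ∧
    (∀ (w : D.W) (y : M'),
      Finite (D.special y) ∧ Finite (D.stab y) ∧ Nat.card (D.stab y) ≤ n ∧
      ∃ S : GroupExtension (D.special y) (MulAction.stabilizer D.WG (D.point w y)) (D.stab y),
        (∀ v, (S.inl v : D.WG) = SemidirectProduct.inl (w * v * w⁻¹)) ∧
        (∀ a, S.rightHom a = a.1.right)) := by
  intro D
  have hfin : IsOfFinOrder ω := isOfFinOrder_iff_pow_eq_one.2 ⟨n, hn, hωn⟩
  have hstab : ∀ x, Finite (D.stab x) :=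
    ReflectionTrick.finite_stab_liftDatum hp hω hT' hfin
  have hcard (x : M') : Nat.card (D.stab x) ≤ n :=
    (ReflectionTrick.card_stab_liftDatum_le hp hω hT' hfin x).trans
      (orderOf_le_of_pow_eq_one hn hωn)
  refine ⟨fun _ _ => D.finite_of_forall_smul_eq, fun w x hx => ?_, fun w y => ?_⟩
  · exact ⟨D.finite_stabilizer_point w x, (D.card_stabilizer_point hx w).trans_le (hcard x)⟩
  · exact ⟨D.finite_special y, hstab y, hcard y, D.stabilizerExtension w y,
      fun _ => rfl, fun _ => rfl⟩

theorem mainTheorem6 {V V' M M' : Type*} [TopologicalSpace M] [TopologicalSpace M']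
    [SimplyConnectedSpace M'] {p : M' → M} (hp : IsCoveringMap p) (hsurj : Function.Surjective p)
    {N : Set M} {T : ReflectionTrick.Triangulation V N}
    (hflag : ReflectionTrick.IsFlag T.complex)
    (hdim : ReflectionTrick.IsFiniteDimensional T.complex)
    {ω : M ≃ₜ M} (hω₂ : ω * ω = 1) (hω : T.IsSimplicial ω)
    {T' : ReflectionTrick.Triangulation V' (p ⁻¹' N)} (hT' : T'.IsLift T) :
    let D := ReflectionTrick.liftDatum hp hω T' hT'
    (∀ (H : Subgroup D.WG) (u : D.U), (∀ h ∈ H, h • u = u) → Finite H) ∧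
    (∀ (w : D.W) (x : M'), x ∉ p ⁻¹' N →
      Finite (MulAction.stabilizer D.WG (D.point w x)) ∧
      Nat.card (MulAction.stabilizer D.WG (D.point w x)) ≤ 2) ∧
    (∀ (w : D.W) (y : M'), y ∈ p ⁻¹' N →
      Finite (D.special y) ∧ Finite (D.stab y) ∧ Nat.card (D.stab y) ≤ 2 ∧
      ∃ S : GroupExtension (D.special y) (MulAction.stabilizer D.WG (D.point w y)) (D.stab y),
        (∀ v, (S.inl v : D.WG) = SemidirectProduct.inl (w * v * w⁻¹)) ∧
        (∀ a, S.rightHom a = a.1.right)) :=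
  have ⟨hH, hx, hy⟩ := mainTheorem6_general hp two_pos ((sq ω).trans hω₂) hω hT'
  ⟨hH, hx, fun w y _ => hy w y⟩
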